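/- Let $N$ be a finite set of players. A local welfare function is a map $W:2^N\to\mathbb{R}$. A distribution rule is a map $f:N\times 2^N\to\mathbb{R}$ with $f(i,S)=0$ whenever $i\notin S$. Let $\mathbb{W}$ be any set of local welfare functions and $f^{\mathbb{W}}=\{f^W\}_{W\in\mathbb{W}}$ a family of distribution rules, one for each $W\in\mathbb{W}$ (not necessarily budget-balanced). The class $\mathcal{G}(N,f^{\mathbb{W}},\mathbb{W})$ consists of all welfare sharing games given by a finite set $R$ of at least two resources, a local welfare function $W_r\in\mathbb{W}$ for each $r\in R$, and a nonempty action set $\mathcal{A}_i\subseteq 2^R$ for each $i\in N$. The utility of player $i$ in the allocation $a=(a_i)_{i\in N}\in\prod_{i\in N}\mathcal{A}_i$ is $U_i(a)=\sum_{r\in a_i}f^{W_r}(i,\{a\}_r)$, where $\{a\}_r=\{j\in N: r\in a_j\}$. A pure Nash equilibrium is an allocation $a^*$ such that $U_i(a_i^*,a_{-i}^*)=\max_{a_i\in\mathcal{A}_i}U_i(a_i,a_{-i}^*)$ for every $i\in N$. A weight system $\omega=(\lambda,\Sigma)$ consists of weights $\lambda_i>0$ $(i\in N)$ and an ordered partition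 $\Sigma=(S_1,\dots,S_m)$ of $N$. For a nonempty $T\subseteq N$ let $\overline{T}=T\cap S_k$, where $k=\min\{j: S_j\cap T\neq\emptyset\}$. For a welfare function $V$, the generalized weighted marginal contribution rule is $$f^{V}_{GWMC}[\omega](i,S)=\lambda_i\bigl(V(\overline{S}_k)-V(\overline{S}_k\setminus\{i\})\bigr),\qquad \overline{S}_k=S\setminus\bigcup_{\ell<k}S_\ell,\quad i\in S_k.$$ Every welfare function can be written uniquely as $V=\sum_{T\subseteq N}q^V_T\,W^T$, where $W^T(S)=1$ if $T\subseteq S$ and $W^T(S)=0$ otherwise. For $V$ with $V(\emptyset)=0$ (so that $q^V_\emptyset=0$), let $$h_\omega(V)=\sum_{\emptyset\ne T\subseteq N}\frac{q^V_T}{\sum_{j\in\overline{T}}\lambda_j}\,W^T .$$ **Theorem.** All games in $\mathcal{G}(N,f^{\mathbb{W}},\mathbb{W})$ possess a pure Nash equilibrium if and only if there exist a weight system $\omega$ and a mapping $g_{MC}$ from $\mathbb{W}$ to welfare functions such that, for every $W\in\mathbb{W}$, $f^W=f^{W''}_{GWMC}[\omega]$ with $W''=g_{MC}(W)=h_\omega(W')$,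 where $W'=g_{SV}(W)$ is the welfare actually distributed by $f^W$, namely $W'(S)=\sum_{i\in S}f^W(i,S)$ for all $S\subseteq N$. -/

import Mathlib

namespace WelfareSharing

/-- A (local) welfare function `W : 2^N → ℝ`. -/
abbrev WelfareFunction (N : Type*) := Finset N → ℝ

/-- A (local) distribution rule: `share i S` is the amount allocated to player `i` when the set of
players sharing is `S`; it is zero when `i` is not in `S`. -/
@[ext]
structure DistributionRule (N : Type*) where
  share : N → Finset N → ℝ
  share_eq_zero : ∀ (i : N) (S : Finset N), i ∉ S → share i S = 0

/-- The strategic data of a welfare sharing game with player set `N` and local welfare functions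
from `𝕎`: a finite set of at least two resources, the local welfare function at every resource, and
a nonempty set of actions (sets of resources) for every player. As a distribution rule is attached
to each member of `𝕎`, resources with the same welfare function have the same rule. -/
structure WelfareGame {N : Type*} (𝕎 : Set (WelfareFunction N)) where
  Resource : Type
  [fintypeResource : Fintype Resource]
  [decEqResource : DecidableEq Resource]
  one_lt_card : 1 < Fintype.card Resource
  welfare : Resource → 𝕎
  actions : N → Finset (Finset Resource)
  actions_nonempty : ∀ i, (actions i).Nonempty

attribute [instance] WelfareGame.fintypeResource WelfareGame.decEqResource

namespace WelfareGame

variable {N : Type*} [Fintype N] [DecidableEq N] {𝕎 : Set (WelfareFunction N)}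

/-- The set of players allocated to resource `r` in the allocation `a`. -/
def users (G : WelfareGame 𝕎) (a : N → Finset G.Resource) (r : G.Resource) : Finset N :=
  Finset.univ.filter fun i => r ∈ a i

/-- The utility of player `i` in the allocation `a`, when the welfare `W ∈ 𝕎` is distributed by the
rule `f W`. -/
def utility (G : WelfareGame 𝕎) (f : 𝕎 → DistributionRule N) (a : N → Finset G.Resource)
    (i : N) : ℝ :=
  ∑ r ∈ a i, (f (G.welfare r)).share i (G.users a r)

/-- `a` is a pure Nash equilibrium: it is feasible, and no player gains by changing its own action
to another one that is available to it. -/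
def IsPureNash (G : WelfareGame 𝕎) (f : 𝕎 → DistributionRule N)
    (a : N → Finset G.Resource) : Prop :=
  (∀ i, a i ∈ G.actions i) ∧
    ∀ i, ∀ b ∈ G.actions i, G.utility f (Function.update a i b) i ≤ G.utility f a i

end WelfareGame

/-- A weight system `(λ, Σ)`: strictly positive player weights, and an ordered partition
`Σ = (S_1, …, S_m)` of the players into nonempty classes, given by the map that sends a player to
the index of its class (a smaller index is a higher priority). -/
structure WeightSystem (N : Type*) where
  weight : N → ℝ
  weight_pos : ∀ i, 0 < weight i
  numClasses : ℕ
  cls : N → Fin numClasses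
  cls_surjective : Function.Surjective cls

namespace WeightSystem

variable {N : Type*} [Fintype N] [DecidableEq N]

/-- The `k`-th class of the ordered partition. -/
def part (ω : WeightSystem N) (k : Fin ω.numClasses) : Finset N :=
  Finset.univ.filter fun i => ω.cls i = k

/-- The highest-priority part of a coalition `T`: its members in the first class that meets `T`. -/
def top (ω : WeightSystem N) (T : Finset N) : Finset N :=
  T.filter fun i => ∀ j ∈ T, ω.cls i ≤ ω.cls j

/-- What remains of `S` once the classes that precede the `k`-th one are removed. -/
def remaining (ω : WeightSystem N) (S : Finset N) (k : Fin ω.numClasses) : Finset N :=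
  S \ (Finset.univ.filter fun l => l < k).biUnion ω.part

end WeightSystem

section

variable {N : Type*} [Fintype N] [DecidableEq N]

/-- The generalized weighted marginal contribution rule on the ground welfare function `W`. -/
def gwmc (ω : WeightSystem N) (W : WelfareFunction N) : DistributionRule N where
  share i S := ω.weight i *
    (W (ω.remaining S (ω.cls i)) - W ((ω.remaining S (ω.cls i)).erase i))
  share_eq_zero i S hi := by
    have h : i ∉ ω.remaining S (ω.cls i) := fun h => hi (Finset.mem_sdiff.1 h).1
    rw [Finset.erase_eq_of_notMem h, sub_self, mul_zero]

/-- The inclusion function (unanimity game) of the coalition `T`. -/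
def inclusion (T : Finset N) : WelfareFunction N := fun S => if T ⊆ S then 1 else 0

/-- The coefficient of `W` on the inclusion function of `T`, in the basis of the inclusion
functions. -/
def coeff (W : WelfareFunction N) (T : Finset N) : ℝ :=
  ∑ R ∈ T.powerset, (-1 : ℝ) ^ (T.card - R.card) * W R

/-- The welfare that is actually distributed by a rule. -/
def distributed (f : DistributionRule N) : WelfareFunction N := fun S => ∑ i ∈ S, f.share i S

/-- The map `h` on welfare functions that vanish at `∅`: the coefficient of `W` on each inclusion
function (which is zero for `T = ∅`) is divided by the total weight of the highest-priority part of
the coalition. -/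
noncomputable def rescale (ω : WeightSystem N) (W : WelfareFunction N) : WelfareFunction N :=
  ∑ T ∈ Finset.univ.filter fun T : Finset N => T.Nonempty,
    (coeff W T / ∑ j ∈ ω.top T, ω.weight j) • inclusion T

end

end WelfareSharing

/-!
For the rules of a common weight system, the change of a player's utility under a deviation is its
weight times the change of a potential that depends only on the players of its class and of the
later ones. Maximizing these potentials lexicographically, the last class first, gives an
equilibrium.

Conversely, the effects of two players on each other's shares can be tested in isolation: if two
copies of a resource are offered and each of the two players uses one of them, then the players
behave like coupled spins. As every game has an equilibrium, the two effects cannot have opposite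
signs. For spins coupled along a closed walk of players, they cannot be stronger in one direction of
the walk than in the other, since otherwise a single frustrated coupling would keep the spins
turning; a player that the walk visits repeatedly owns one spin for each visit. Hence the products
of the effects along a closed walk agree in both directions. The vanishing of effects then defines
the priorities and the ratios of the others define the weights. By Möbius inversion, the
coefficients of the shares on the inclusion functions obey the same relations, which determine the
shares from the welfare that is distributed.
-/

namespace WelfareSharing

section Potential

variable {N : Type*} [Fintype N] {𝕎 : Set (WelfareFunction N)}

theorem WelfareGame.utility_eq_sum_univ (G : WelfareGame 𝕎) (f : 𝕎 → DistributionRule N)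
    (a : N → Finset G.Resource) (i : N) :
    G.utility f a i = ∑ r, (f (G.welfare r)).share i (G.users a r) :=
  Finset.sum_subset (Finset.subset_univ _) fun r _ hr =>
    (f (G.welfare r)).share_eq_zero i _ (by simpa [WelfareGame.users] using hr)

variable [DecidableEq N]

theorem WelfareGame.erase_users_update (G : WelfareGame 𝕎) (a : N → Finset G.Resource) (i : N)
    (b : Finset G.Resource) (r : G.Resource) :
    (G.users (Function.update a i b) r).erase i = (G.users a r).erase i := by
  ext j
  by_cases hj : j = i <;> simp [WelfareGame.users, hj]

namespace WeightSystem

variable (ω : WeightSystem N) {S : Finset N} {i : N} {k : Fin ω.numClasses}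

theorem mem_remaining : i ∈ ω.remaining S k ↔ i ∈ S ∧ k ≤ ω.cls i := by
  simp [remaining, part]

theorem erase_remaining : (ω.remaining S k).erase i = ω.remaining (S.erase i) k := by
  rw [remaining, remaining, Finset.erase_sdiff_comm]

theorem remaining_erase_of_cls_lt (hi : ω.cls i < k) :
    ω.remaining (S.erase i) k = ω.remaining S k := by
  rw [← erase_remaining, Finset.erase_eq_of_notMem fun h => (ω.mem_remaining.1 h).2.not_gt hi]

end WeightSystem

namespace WelfareGame

variable (G : WelfareGame 𝕎) (ω : WeightSystem N) (V : 𝕎 → WelfareFunction N)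
  (a : N → Finset G.Resource)

/-- The potential of the `k`-th class of players for the rules `gwmc ω (V W)`: the total ground
welfare that remains once the classes of higher priority are removed. -/
def classPotential (k : Fin ω.numClasses) : ℝ :=
  ∑ r, V (G.welfare r) (ω.remaining (G.users a r) k)

theorem classPotential_update_of_cls_lt {i : N} (b : Finset G.Resource) {k : Fin ω.numClasses}
    (hk : ω.cls i < k) :
    G.classPotential ω V (Function.update a i b) k = G.classPotential ω V a k := by
  refine Finset.sum_congr rfl fun r _ => ?_
  rw [← ω.remaining_erase_of_cls_lt hk, G.erase_users_update, ω.remaining_erase_of_cls_lt hk]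

theorem utility_gwmc_update_sub (i : N) (b : Finset G.Resource) :
    G.utility (fun W => gwmc ω (V W)) (Function.update a i b) i -
        G.utility (fun W => gwmc ω (V W)) a i =
      ω.weight i * (G.classPotential ω V (Function.update a i b) (ω.cls i) -
        G.classPotential ω V a (ω.cls i)) := by
  simp only [utility_eq_sum_univ, classPotential, gwmc, ← Finset.sum_sub_distrib, Finset.mul_sum,
    ω.erase_remaining, G.erase_users_update]
  exact Finset.sum_congr rfl fun r _ => by ring

theorem exists_isPureNash_gwmc : ∃ a, G.IsPureNash (fun W => gwmc ω (V W)) a := by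
  let Φ : (N → Finset G.Resource) → Lex ((Fin ω.numClasses)ᵒᵈ → ℝ) :=
    fun a => toLex fun k => G.classPotential ω V a (OrderDual.ofDual k)
  obtain ⟨a, ha, hmax⟩ := Finset.exists_max_image (Fintype.piFinset G.actions) Φ
    (Fintype.piFinset_nonempty.2 G.actions_nonempty)
  rw [Fintype.mem_piFinset] at ha
  refine ⟨a, ha, fun i b hb => ?_⟩
  have hfeasible : Function.update a i b ∈ Fintype.piFinset G.actions :=
    Fintype.mem_piFinset.2 (Function.forall_update_iff a (fun j c => c ∈ G.actions j) |>.2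
      ⟨hb, fun j _ => ha j⟩)
  by_contra! hgain
  have hincrease : G.classPotential ω V a (ω.cls i) <
      G.classPotential ω V (Function.update a i b) (ω.cls i) := by
    rw [← sub_pos, G.utility_gwmc_update_sub, mul_pos_iff_of_pos_left (ω.weight_pos i)] at hgain
    exact sub_pos.1 hgain
  refine (hmax _ hfeasible).not_gt ⟨OrderDual.toDual (ω.cls i), fun k hk => ?_, hincrease⟩
  exact (G.classPotential_update_of_cls_lt ω V a b (OrderDual.ofDual_lt_ofDual.2 hk)).symm

end WelfareGame

end Potential

section SpinGame

variable {N : Type*} {𝕎 : Set (WelfareFunction N)} {ι : Type*}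

/-- A coupling of two spins. The spins are indexed by `ι`, and each of them is chosen by one player,
its owner; a player may own several. A coupling is realized by two copies of a resource, which are
labelled by the elements of `ℤˣ` and which the players of `coalition` may use. The owner of `fst`
uses only the copy that this spin selects, the owner of `snd` only the copy that `sign` times this
spin selects, and the other players use both. -/
structure Coupling (𝕎 : Set (WelfareFunction N)) (ι : Type*) where
  welfare : 𝕎
  coalition : Finset N
  fst : ι
  snd : ι
  sign : ℤˣ

namespace Coupling

/-- The spin product that decides whether the two owners meet at the same copy: it is `1` if they
do and `-1` otherwise. -/
def alignment (C : Coupling 𝕎 ι) (t : ι → ℤˣ) : ℤˣ := C.sign * t C.fst * t C.snd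

variable {C : Coupling 𝕎 ι} {t : ι → ℤˣ}

theorem alignment_eq_one_iff : C.alignment t = 1 ↔ t C.fst = C.sign * t C.snd := by
  unfold alignment
  generalize C.sign = s, t C.fst = a, t C.snd = b
  decide +revert

theorem alignment_update_neg [DecidableEq ι] (hC : C.fst ≠ C.snd) {x : ι}
    (hx : C.fst = x ∨ C.snd = x) :
    C.alignment (Function.update t x (-t x)) = -C.alignment t := by
  rcases hx with rfl | rfl <;> simp [alignment, hC, hC.symm]

end Coupling

theorem ite_eq_one_sub_ite_neg_eq_one (s : ℤˣ) (y : ℝ) :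
    (if s = 1 then y else 0) - (if -s = 1 then y else 0) = s * y := by
  rcases Int.units_eq_one_or s with rfl | rfl <;> simp

variable [DecidableEq N]

/-- The effect of player `j` on the share of player `i` in the coalition `T`. -/
def DistributionRule.externality (g : DistributionRule N) (T : Finset N) (i j : N) : ℝ :=
  g.share i T - g.share i (T.erase j)

namespace Coupling

variable (C : Coupling 𝕎 ι) (owner : ι → N) (f : 𝕎 → DistributionRule N) (t : ι → ℤˣ)

/-- The users of the copy `c` of the resource when the spins are `t`. -/
def users (c : ℤˣ) : Finset N :=
  C.coalition.filter fun p =>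
    (owner C.fst = p → t C.fst = c) ∧ (owner C.snd = p → C.sign * t C.snd = c)

/-- The total share of the player `p` in both copies of the resource when the spins are `t`. -/
def totalShare (p : N) : ℝ := ∑ c, (f C.welfare).share p (C.users owner t c)

/-- The gain of the owner of the spin `x` from meeting the owner of the other spin. -/
def force [DecidableEq ι] (x : ι) : ℝ :=
  (if C.fst = x then
    (f C.welfare).externality C.coalition (owner C.fst) (owner C.snd) else 0) +
  if C.snd = x then
    (f C.welfare).externality C.coalition (owner C.snd) (owner C.fst) else 0

variable {C owner f t}

theorem totalShare_fst :
    C.totalShare owner f t (owner C.fst) =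
      (f C.welfare).share (owner C.fst) (C.coalition.erase (owner C.snd)) +
        if C.alignment t = 1 then
          (f C.welfare).externality C.coalition (owner C.fst) (owner C.snd) else 0 := by
  rw [totalShare, Fintype.sum_eq_single (t C.fst) fun c hc =>
    (f C.welfare).share_eq_zero _ _ (by simp [users, hc.symm])]
  have husers : C.users owner t (t C.fst) =
      if C.alignment t = 1 then C.coalition else C.coalition.erase (owner C.snd) := by
    simp only [alignment_eq_one_iff, eq_comm (a := t C.fst)]
    split_ifs with h <;> ext p <;> simp [users, h, and_comm, eq_comm]
  rw [husers, DistributionRule.externality]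
  split_ifs <;> ring

theorem totalShare_snd :
    C.totalShare owner f t (owner C.snd) =
      (f C.welfare).share (owner C.snd) (C.coalition.erase (owner C.fst)) +
        if C.alignment t = 1 then
          (f C.welfare).externality C.coalition (owner C.snd) (owner C.fst) else 0 := by
  rw [totalShare, Fintype.sum_eq_single (C.sign * t C.snd) fun c hc =>
    (f C.welfare).share_eq_zero _ _ (by simp [users, hc.symm])]
  have husers : C.users owner t (C.sign * t C.snd) =
      if C.alignment t = 1 then C.coalition else C.coalition.erase (owner C.fst) := by
    simp only [alignment_eq_one_iff]
    split_ifs with h <;> ext p <;> simp [users, h, and_comm, eq_comm]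
  rw [husers, DistributionRule.externality]
  split_ifs <;> ring

theorem totalShare_sub_totalShare_update_neg [DecidableEq ι] (hC : C.fst ≠ C.snd) (x : ι) :
    C.totalShare owner f t (owner x) -
        C.totalShare owner f (Function.update t x (-t x)) (owner x) =
      C.alignment t * C.force owner f x := by
  by_cases hfst : C.fst = x
  · have hsnd : C.snd ≠ x := hfst ▸ hC.symm
    rw [force, if_pos hfst, if_neg hsnd, add_zero, ← ite_eq_one_sub_ite_neg_eq_one,
      ← alignment_update_neg hC (.inl hfst), ← hfst, totalShare_fst, totalShare_fst,
      add_sub_add_left_eq_sub]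
  by_cases hsnd : C.snd = x
  · rw [force, if_neg hfst, if_pos hsnd, zero_add, ← ite_eq_one_sub_ite_neg_eq_one,
      ← alignment_update_neg hC (.inr hsnd), ← hsnd, totalShare_snd, totalShare_snd,
      add_sub_add_left_eq_sub]
  · simp [force, totalShare, users, hfst, hsnd]

end Coupling

variable {E : Type} [Fintype E] (C : E → Coupling 𝕎 ι) (owner : ι → N)

/-- The resources that the player `p` uses when it chooses its spins as in `t`. -/
def spinAction (p : N) (t : ι → ℤˣ) : Finset (E × ℤˣ) :=
  Finset.univ.filter fun r => p ∈ (C r.1).users owner t r.2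

theorem spinAction_congr {p : N} {t t' : ι → ℤˣ} (h : ∀ x, owner x = p → t x = t' x) :
    spinAction C owner p t = spinAction C owner p t' := by
  ext r
  simp +contextual [spinAction, Coupling.users, h]

section

variable [Fintype ι] [DecidableEq ι] [DecidableEq E] [Nonempty E]

/-- The game in which every player chooses the spins that it owns, and in which these are coupled
by `C`. -/
abbrev spinGame : WelfareGame 𝕎 where
  Resource := E × ℤˣ
  one_lt_card := by
    have := Fintype.card_pos (α := E)
    rw [Fintype.card_prod, Fintype.card_units_int]
    lia
  welfare r := (C r.1).welfare
  actions p := Finset.univ.image (spinAction C owner p)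
  actions_nonempty _ := Finset.univ_nonempty.image _

theorem utility_spinGame [Fintype N] (f : 𝕎 → DistributionRule N) (t : ι → ℤˣ) (p : N) :
    (spinGame C owner).utility f (fun q => spinAction C owner q t) p =
      ∑ e, (C e).totalShare owner f t p := by
  have husers (r : E × ℤˣ) : (spinGame C owner).users (fun q => spinAction C owner q t) r =
      (C r.1).users owner t r.2 := by
    ext q
    simp [WelfareGame.users, spinAction]
  rw [WelfareGame.utility_eq_sum_univ]
  simp only [husers]
  exact Fintype.sum_prod_type _

end

variable [Fintype N]

/-- Every welfare sharing game with the rules `f` has a pure Nash equilibrium. -/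
def GuaranteesNash (f : 𝕎 → DistributionRule N) : Prop :=
  ∀ G : WelfareGame 𝕎, ∃ a : N → Finset G.Resource, G.IsPureNash f a

variable {C owner} [Finite ι] [DecidableEq ι] [Nonempty E]

theorem GuaranteesNash.exists_stable_spins {f : 𝕎 → DistributionRule N} (hf : GuaranteesNash f)
    (hC : ∀ e, (C e).fst ≠ (C e).snd) :
    ∃ t : ι → ℤˣ, ∀ x, 0 ≤ ∑ e, (C e).alignment t * (C e).force owner f x := by
  classical
  have := Fintype.ofFinite ι
  obtain ⟨a, ha, hopt⟩ := hf (spinGame C owner)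
  choose u hu using fun p => Finset.mem_image.1 (ha p)
  let t : ι → ℤˣ := fun x => u (owner x) x
  obtain rfl : a = fun p => spinAction C owner p t := funext fun p =>
    (hu p).2.symm.trans (spinAction_congr C owner fun x hx => by simp only [t, hx])
  refine ⟨t, fun x => ?_⟩
  let t' := Function.update t x (-t x)
  have hdeviation : Function.update (fun p => spinAction C owner p t) (owner x)
      (spinAction C owner (owner x) t') = fun p => spinAction C owner p t' := by
    refine Function.update_eq_iff.2 ⟨rfl, fun p hp => spinAction_congr C owner fun y hy => ?_⟩
    exact (Function.update_of_ne (fun hyx => hp (by rw [← hy, hyx])) _ _).symm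
  have hx := hopt (owner x) _ (Finset.mem_image_of_mem (spinAction C owner _) (Finset.mem_univ t'))
  rw [hdeviation, utility_spinGame, utility_spinGame, ← sub_nonneg, ← Finset.sum_sub_distrib] at hx
  simpa only [t', Coupling.totalShare_sub_totalShare_update_neg (hC _)] using hx

end SpinGame

section Cycle

theorem exists_rescaling_of_prod_le_prod {n : ℕ} {a b : Fin (n + 1) → ℝ} (ha : ∀ i, 0 < a i)
    (hb : ∀ i, 0 < b i) (hle : ∏ i, a i ≤ ∏ i, b i) :
    ∃ c : Fin (n + 1) → ℝ, (∀ i, 0 < c i) ∧ ∀ i, c (i + 1) * a (i + 1) ≤ c i * b i := by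
  let d : Fin (n + 1) → ℝ := fun i => ∏ j ∈ Finset.Ioi i, a j / b j
  have hd (i) : d i / b i * a i = ∏ j ∈ Finset.Ici i, a j / b j := by
    rw [← Finset.prod_Ioi_mul_eq_prod_Ici, div_mul_eq_mul_div, mul_div_assoc]
  refine ⟨fun i => d i / b i, fun i =>
    div_pos (Finset.prod_pos fun j _ => div_pos (ha j) (hb j)) (hb i), fun i => ?_⟩
  rw [hd, div_mul_cancel₀ _ (hb i).ne']
  cases i using Fin.lastCases with
  | last =>
    have hle_one : ∏ j, a j / b j ≤ 1 := by
      rw [Finset.prod_div_distrib]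
      exact div_le_one_of_le₀ hle (Finset.prod_nonneg fun j _ => (hb j).le)
    rw [Fin.last_add_one]
    simpa [d, ← Fin.top_eq_last, ← bot_eq_zero] using hle_one
  | cast i =>
    refine (Finset.prod_congr ?_ fun _ _ => rfl).le
    ext j
    simp [Fin.coeSucc_eq_succ, Fin.castSucc_lt_iff_succ_le]

open Filter Topology in
theorem exists_nat_rescaling_of_prod_lt_prod {n : ℕ} {a b : Fin (n + 1) → ℝ} (ha : ∀ i, 0 ≤ a i)
    (hb : ∀ i, 0 ≤ b i) (hlt : ∏ i, a i < ∏ i, b i) :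
    ∃ c : Fin (n + 1) → ℕ, ∀ i, c (i + 1) * a (i + 1) < c i * b i := by
  have hb_pos (i) : 0 < b i := (hb i).lt_of_ne' fun h =>
    (Finset.prod_nonneg fun j _ => ha j).not_gt (by simpa [Finset.prod_eq_zero _ h] using hlt)
  have hperturb : Tendsto (fun ε : ℝ => ∏ i, (a i + ε)) (𝓝[>] 0) (𝓝 (∏ i, a i)) := by
    have : Continuous fun ε : ℝ => ∏ i, (a i + ε) := by fun_prop
    simpa using (this.tendsto 0).mono_left nhdsWithin_le_nhds
  obtain ⟨ε, hε, hε_pos : 0 < ε⟩ :=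
    ((hperturb.eventually_lt_const hlt).and self_mem_nhdsWithin).exists
  obtain ⟨c, hc, hcab⟩ := exists_rescaling_of_prod_le_prod
    (fun i => add_pos_of_nonneg_of_pos (ha i) hε_pos) hb_pos hε.le
  have hstrict (i) : c (i + 1) * a (i + 1) < c i * b i :=
    (mul_lt_mul_of_pos_left (lt_add_of_pos_right _ hε_pos) (hc _)).trans_le (hcab i)
  have hfloor (i) : Tendsto (fun K : ℝ => (⌊c i * K⌋₊ : ℝ) / K) atTop (𝓝 (c i)) :=
    tendsto_nat_floor_mul_div_atTop (hc i).le
  obtain ⟨K, hK, hK_pos⟩ := ((eventually_all.2 fun i => ((hfloor (i + 1)).mul_const _).eventually_lt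
    ((hfloor i).mul_const _) (hstrict i)).and (eventually_gt_atTop (0 : ℝ))).exists
  refine ⟨fun i => ⌊c i * K⌋₊, fun i => ?_⟩
  simpa only [div_mul_eq_mul_div, div_lt_div_iff_of_pos_right hK_pos] using hK i

theorem exists_units_mul_eq_abs (x : ℝ) : ∃ u : ℤˣ, u * x = |x| := by
  rcases abs_choice x with h | h
  · exact ⟨1, by simp [h]⟩
  · exact ⟨-1, by simp [h]⟩

theorem units_mul_le_abs (u : ℤˣ) (x : ℝ) : u * x ≤ |x| := by
  rcases Int.units_eq_one_or u with rfl | rfl <;> simp [le_abs_self, neg_le_abs]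

variable {N : Type*} [Fintype N] [DecidableEq N] {𝕎 : Set (WelfareFunction N)}
  {f : 𝕎 → DistributionRule N}

theorem GuaranteesNash.externality_mul_externality_nonneg (hf : GuaranteesNash f) (W : 𝕎)
    (T : Finset N) (i j : N) : 0 ≤ (f W).externality T i j * (f W).externality T j i := by
  obtain ⟨t, ht⟩ := hf.exists_stable_spins (E := Unit) (owner := fun x => bif x then i else j)
    (C := fun _ => ⟨W, T, true, false, 1⟩) (by simp)
  have hi := ht true
  have hj := ht false
  simp only [Coupling.force, Finset.univ_unique, Finset.sum_singleton, if_true, reduceCtorEq,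
    if_false, add_zero, zero_add, cond_true, cond_false] at hi hj
  generalize Coupling.alignment _ t = s at hi hj
  rcases Int.units_eq_one_or s with rfl | rfl
  · exact mul_nonneg (by simpa using hi) (by simpa using hj)
  · exact mul_nonneg_of_nonpos_of_nonpos (by simpa using hi) (by simpa using hj)

theorem GuaranteesNash.exists_stable_spins_of_cycle (hf : GuaranteesNash f) {n : ℕ}
    (v : Fin (n + 2) → N) (W : Fin (n + 2) → 𝕎) (T : Fin (n + 2) → Finset N)
    (c : Fin (n + 2) → ℕ) {k : Fin (n + 2)} (hk : 0 < c k) (s : Fin (n + 2) → ℤˣ) :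
    ∃ t : Fin (n + 2) → ℤˣ, ∀ i,
      0 ≤ c (i + 1) * (((s (i + 1) * t (i + 1) * t (i + 1 + 1) : ℤˣ) : ℝ) *
          (f (W (i + 1))).externality (T (i + 1)) (v (i + 1)) (v (i + 1 + 1))) +
        c i * (((s i * t i * t (i + 1) : ℤˣ) : ℝ) *
          (f (W i)).externality (T i) (v (i + 1)) (v i)) := by
  have : Nonempty (Σ i, Fin (c i)) := ⟨k, 0, hk⟩
  obtain ⟨t, ht⟩ := hf.exists_stable_spins (owner := v)
    (C := fun e : Σ i, Fin (c i) => ⟨W e.1, T e.1, e.1, e.1 + 1, s e.1⟩) (by simp)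
  refine ⟨t, fun i => ?_⟩
  simpa [Fintype.sum_sigma, Coupling.force, Coupling.alignment, mul_add,
    Finset.sum_add_distrib] using ht (i + 1)

theorem prod_mul_add_one_eq_one (n : ℕ) (t : Fin (n + 1) → ℤˣ) : ∏ i, t i * t (i + 1) = 1 := by
  rw [Finset.prod_mul_distrib, ← Int.units_mul_self (∏ i, t i)]
  exact congrArg _ (Equiv.prod_comp (Equiv.addRight 1) t)

/-- If the product were larger, `c i` copies of the `i`-th coupling would make every spin care more
about its predecessor than about its successor. By the choice of `u`, every spin then wants to equal
its predecessor, except that `η` makes the spin `1` want to differ from the spin `0`. These wishes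
cannot all be satisfied around the cycle. -/
theorem GuaranteesNash.prod_abs_externality_le_of_cycle (hf : GuaranteesNash f) {n : ℕ}
    (v : Fin (n + 1) → N) (W : Fin (n + 1) → 𝕎) (T : Fin (n + 1) → Finset N) :
    ∏ i, |(f (W i)).externality (T i) (v (i + 1)) (v i)| ≤
      ∏ i, |(f (W i)).externality (T i) (v i) (v (i + 1))| := by
  obtain _ | n := n
  · simp
  by_contra! hlt
  obtain ⟨c, hc⟩ := exists_nat_rescaling_of_prod_lt_prod (fun _ => abs_nonneg _)
    (fun _ => abs_nonneg _) hlt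
  have hc_pos : 0 < c 0 := by
    have := (mul_nonneg (Nat.cast_nonneg _) (abs_nonneg _)).trans_lt (hc 0)
    exact_mod_cast pos_of_mul_pos_left this (abs_nonneg _)
  choose u hu using fun i => exists_units_mul_eq_abs
    ((f (W i)).externality (T i) (v (i + 1)) (v i))
  let η : Fin (n + 2) → ℤˣ := Pi.mulSingle 0 (-1)
  obtain ⟨t, ht⟩ := hf.exists_stable_spins_of_cycle v W T c hc_pos fun i => η i * u i
  have haligned (i) : η i * (t i * t (i + 1)) = 1 := by
    refine (Int.units_eq_one_or _).resolve_right fun hopposed => ?_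
    have hforce := ht i
    rw [show η i * u i * t i * t (i + 1) = -u i by
      rw [mul_right_comm (η i), mul_right_comm, mul_assoc (η i), hopposed, neg_one_mul]] at hforce
    rw [Units.val_neg, Int.cast_neg, neg_mul, hu] at hforce
    have hother := mul_le_mul_of_nonneg_left (units_mul_le_abs
      (η (i + 1) * u (i + 1) * t (i + 1) * t (i + 1 + 1))
      ((f (W (i + 1))).externality (T (i + 1)) (v (i + 1)) (v (i + 1 + 1))))
      (Nat.cast_nonneg (c (i + 1)))
    linarith [hc i]
  have hfrustrated : ∏ i, η i * (t i * t (i + 1)) = -1 := by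
    rw [Finset.prod_mul_distrib, prod_mul_add_one_eq_one, mul_one, Finset.prod_pi_mulSingle',
      if_pos (Finset.mem_univ _)]
  simp [haligned] at hfrustrated

end Cycle

section Walk

variable {N : Type*} [DecidableEq N] {𝕎 : Set (WelfareFunction N)}
  {f : 𝕎 → DistributionRule N}

/-- `Walk f p q x y` says that some sequence of players leads from `p` to `q`, with a rule and a
coalition chosen at every step, in which `x` is the product over the steps of the absolute
externality of the target on the source, and `y` that of the source on the target. -/
inductive Walk (f : 𝕎 → DistributionRule N) : N → N → ℝ → ℝ → Prop
  | nil (p : N) : Walk f p p 1 1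
  | cons (W : 𝕎) (T : Finset N) (p : N) {q r : N} {x y : ℝ} (hw : Walk f q r x y) :
    Walk f p r (|(f W).externality T p q| * x) (|(f W).externality T q p| * y)

namespace Walk

variable {p q r : N} {x y x' y' : ℝ}

theorem trans (hw : Walk f p q x y) (hw' : Walk f q r x' y') :
    Walk f p r (x * x') (y * y') := by
  induction hw with
  | nil => simpa only [one_mul] using hw'
  | cons W T p _ ih => simpa only [mul_assoc] using (ih hw').cons W T p

theorem single (f : 𝕎 → DistributionRule N) (W : 𝕎) (T : Finset N) (p q : N) :
    Walk f p q |(f W).externality T p q| |(f W).externality T q p| := by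
  simpa only [mul_one] using (nil (f := f) q).cons W T p

theorem symm (hw : Walk f p q x y) : Walk f q p y x := by
  induction hw with
  | nil p => exact nil p
  | @cons W T p q _ _ _ _ ih => simpa only [mul_comm] using ih.trans (single f W T q p)

theorem nonneg (hw : Walk f p q x y) : 0 ≤ x := by
  induction hw with
  | nil => exact zero_le_one
  | cons _ _ _ _ ih => exact mul_nonneg (abs_nonneg _) ih

theorem exists_eq_prod (hw : Walk f p q x y) :
    ∃ (n : ℕ) (v : Fin (n + 1) → N) (W : Fin n → 𝕎) (T : Fin n → Finset N),
      v 0 = p ∧ v (Fin.last n) = q ∧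
      x = ∏ i, |(f (W i)).externality (T i) (v i.castSucc) (v i.succ)| ∧
      y = ∏ i, |(f (W i)).externality (T i) (v i.succ) (v i.castSucc)| := by
  induction hw with
  | nil p => exact ⟨0, fun _ => p, finZeroElim, finZeroElim, rfl, rfl, by simp, by simp⟩
  | cons W T p _ ih =>
    obtain ⟨n, v, Ws, Ts, rfl, rfl, rfl, rfl⟩ := ih
    refine ⟨n + 1, Fin.cons p v, Fin.cons W Ws, Fin.cons T Ts, rfl, rfl, ?_, ?_⟩ <;>
      simp [Fin.prod_univ_succ]

theorem le_of_closed [Fintype N] (hf : GuaranteesNash f) (hw : Walk f p p x y) : y ≤ x := by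
  obtain ⟨_ | n, v, W, T, hfst, hlast, rfl, rfl⟩ := hw.exists_eq_prod
  · simp
  have hsucc (i : Fin (n + 1)) : v i.succ = v (i + 1).castSucc := by
    cases i using Fin.lastCases with
    | last => rw [Fin.succ_last, Fin.last_add_one, hlast, Fin.castSucc_zero, hfst]
    | cast i => rw [Fin.coeSucc_eq_succ, Fin.succ_castSucc]
  simpa only [hsucc] using hf.prod_abs_externality_le_of_cycle (fun i => v i.castSucc) W T

theorem eq_of_closed [Fintype N] (hf : GuaranteesNash f) (hw : Walk f p p x y) : x = y :=
  le_antisymm (hw.symm.le_of_closed hf) (hw.le_of_closed hf)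

end Walk

end Walk

section Weights

theorem exists_surjective_monotone_rank (α : Type*) [Preorder α] [Finite α] :
    ∃ (m : ℕ) (rank : α → Fin m), Function.Surjective rank ∧ Monotone rank ∧
      ∀ p q, rank p = rank q → p ≤ q := by
  classical
  let L := LinearExtension (Antisymmetrization α (· ≤ ·))
  let mk : α → L := fun p => toLinearExtension (toAntisymmetrization (· ≤ ·) p)
  have hmk : Function.Surjective mk := Quotient.mk_surjective
  have : Fintype L := @Fintype.ofFinite L (Finite.of_surjective mk hmk)
  let e : L ≃o Fin (Fintype.card L) := (Fintype.orderIsoFinOfCardEq L rfl).symm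
  refine ⟨_, e ∘ mk, e.surjective.comp hmk, ?_, fun p q h => ?_⟩
  · exact e.monotone.comp (toLinearExtension.monotone.comp toAntisymmetrization_mono)
  · exact (Quotient.exact (e.injective h)).1

variable {N : Type*} [DecidableEq N] {𝕎 : Set (WelfareFunction N)}
  {f : 𝕎 → DistributionRule N}

/-- The player `p` outranks `q` if, along some walk from `p` to `q`, every player is affected by the
next one. The class of `p` then cannot come after that of `q` in any weight system that represents
the rules `f`. -/
def Outranks (f : 𝕎 → DistributionRule N) (p q : N) : Prop :=
  ∃ x y, 0 < x ∧ Walk f p q x y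

namespace Outranks

theorem refl (f : 𝕎 → DistributionRule N) (p : N) : Outranks f p p :=
  ⟨1, 1, one_pos, .nil p⟩

theorem trans {p q r : N} (hpq : Outranks f p q) (hqr : Outranks f q r) : Outranks f p r := by
  obtain ⟨x, y, hx, hw⟩ := hpq
  obtain ⟨x', y', hx', hw'⟩ := hqr
  exact ⟨x * x', y * y', mul_pos hx hx', hw.trans hw'⟩

theorem of_externality_ne_zero {W : 𝕎} {T : Finset N} {p q : N}
    (h : (f W).externality T p q ≠ 0) : Outranks f p q :=
  ⟨_, _, abs_pos.2 h, .single f W T p q⟩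

end Outranks

theorem GuaranteesNash.exists_weight [Fintype N] (hf : GuaranteesNash f) {α : Type*} {rank : N → α}
    (hsurj : Function.Surjective rank) (hrank : ∀ p q, rank p = rank q → Outranks f p q) :
    ∃ l : N → ℝ, (∀ p, 0 < l p) ∧
      ∀ p q x y, rank p = rank q → Walk f p q x y → x * l q = y * l p := by
  let base : N → N := fun p => Function.surjInv hsurj (rank p)
  have hbase (p) : rank (base p) = rank p := Function.surjInv_eq hsurj _
  have hwalk (p) : ∃ x y, 0 < x ∧ 0 < y ∧ Walk f (base p) p x y := by
    obtain ⟨x, y, hx, hw⟩ := hrank _ _ (hbase p)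
    obtain ⟨x', y', hx', hw'⟩ := hrank _ _ (hbase p).symm
    have heq := (hw.trans hw').eq_of_closed hf
    exact ⟨x, y, hx, pos_of_mul_pos_left (heq ▸ mul_pos hx hx') hw'.symm.nonneg, hw⟩
  choose X Y hX hY hXY using hwalk
  refine ⟨fun p => Y p / X p, fun p => div_pos (hY p) (hX p), fun p q x y hpq hw => ?_⟩
  have hq := hXY q
  rw [show base q = base p from congrArg (Function.surjInv hsurj) hpq.symm] at hq
  have hclosed := (((hXY p).trans hw).trans hq.symm).eq_of_closed hf
  have hXp := (hX p).ne'
  have hXq := (hX q).ne'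
  field_simp
  linarith

/-- The relations between externalities by which a generalized weighted marginal contribution rule
is recognized: a player is never affected by one of higher priority, and the effects of two players
of the same class on each other are proportional to the weights of the affected players. -/
def WeightSystem.IsProportional (ω : WeightSystem N) (g : DistributionRule N) : Prop :=
  ∀ T i j, (ω.cls i < ω.cls j → g.externality T j i = 0) ∧
    (ω.cls i = ω.cls j → g.externality T i j * ω.weight j = g.externality T j i * ω.weight i)

theorem eq_of_abs_eq_abs_of_mul_nonneg {x y : ℝ} (h : |x| = |y|) (hxy : 0 ≤ x * y) : x = y := by
  rcases abs_eq_abs.1 h with h | rfl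
  · exact h
  · have : y = 0 := by nlinarith
    rw [this, neg_zero]

theorem GuaranteesNash.exists_isProportional [Fintype N] (hf : GuaranteesNash f) :
    ∃ ω : WeightSystem N, ∀ W, ω.IsProportional (f W) := by
  let outranks : Preorder N :=
    { le := Outranks f
      le_refl := .refl f
      le_trans := fun _ _ _ => .trans }
  obtain ⟨m, rank, hsurj, hmono, hrank⟩ := exists_surjective_monotone_rank N
  obtain ⟨l, hl, hwalk⟩ := hf.exists_weight hsurj hrank
  refine ⟨⟨l, hl, m, rank, hsurj⟩, fun W T i j => ⟨fun hlt => ?_, fun heq => ?_⟩⟩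
  · by_contra hne
    exact (hmono (Outranks.of_externality_ne_zero hne)).not_gt hlt
  · refine eq_of_abs_eq_abs_of_mul_nonneg ?_ ?_
    · rw [abs_mul, abs_mul, abs_of_pos (hl j), abs_of_pos (hl i)]
      exact hwalk i j _ _ heq (.single f W T i j)
    · rw [mul_mul_mul_comm]
      exact mul_nonneg (hf.externality_mul_externality_nonneg W T i j) (mul_pos (hl j) (hl i)).le

end Weights

section Coefficients

variable {N : Type*}

theorem coeff_sub (V W : WelfareFunction N) (T : Finset N) :
    coeff (fun S => V S - W S) T = coeff V T - coeff W T := by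
  simp only [coeff, mul_sub, Finset.sum_sub_distrib]

theorem coeff_share_eq_zero (g : DistributionRule N) {i : N} {T : Finset N} (hi : i ∉ T) :
    coeff (g.share i) T = 0 :=
  Finset.sum_eq_zero fun R hR => by
    rw [g.share_eq_zero i R fun h => hi (Finset.mem_powerset.1 hR h), mul_zero]

theorem coeff_distributed (g : DistributionRule N) (T : Finset N) :
    coeff (distributed g) T = ∑ i ∈ T, coeff (g.share i) T := by
  unfold coeff distributed
  rw [Finset.sum_comm]
  refine Finset.sum_congr rfl fun R hR => ?_
  rw [← Finset.mul_sum]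
  congr 1
  exact Finset.sum_subset (Finset.mem_powerset.1 hR) fun i _ hi => g.share_eq_zero i R hi

theorem coeff_insert [DecidableEq N] (W : WelfareFunction N) {T : Finset N} {i : N}
    (hi : i ∉ T) : coeff W (insert i T) = coeff (fun S => W (insert i S)) T - coeff W T := by
  unfold coeff
  rw [Finset.sum_powerset_insert hi, add_comm, sub_eq_add_neg, ← Finset.sum_neg_distrib]
  refine congrArg₂ _ (Finset.sum_congr rfl fun R hR => ?_) (Finset.sum_congr rfl fun R hR => ?_)
  · have hR' := Finset.mem_powerset.1 hR
    rw [Finset.card_insert_of_notMem hi, Finset.card_insert_of_notMem fun h => hi (hR' h),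
      Nat.add_sub_add_right]
  · have := Finset.card_le_card (Finset.mem_powerset.1 hR)
    rw [Finset.card_insert_of_notMem hi, Nat.sub_add_comm this, pow_succ]
    ring

theorem sum_coeff_powerset (W : WelfareFunction N) (S : Finset N) :
    ∑ T ∈ S.powerset, coeff W T = W S := by
  classical
  induction S using Finset.induction_on generalizing W with
  | empty => simp [coeff]
  | insert i S hi ih =>
    rw [Finset.sum_powerset_insert hi, ← Finset.sum_add_distrib, ← ih fun S => W (insert i S)]
    refine Finset.sum_congr rfl fun T hT => ?_
    rw [coeff_insert W fun h => hi (Finset.mem_powerset.1 hT h)]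
    ring

variable [DecidableEq N]

theorem coeff_erase_eq_zero (W : WelfareFunction N) {T : Finset N} {j : N} (hj : j ∈ T) :
    coeff (fun S => W (S.erase j)) T = 0 := by
  rw [← Finset.insert_erase hj, coeff_insert _ (Finset.notMem_erase j T), sub_eq_zero]
  refine Finset.sum_congr rfl fun R _ => ?_
  simp only [Finset.erase_insert_eq_erase]

theorem coeff_externality (g : DistributionRule N) {T : Finset N} {i j : N} (hj : j ∈ T) :
    coeff (fun S => g.externality S i j) T = coeff (g.share i) T := by
  unfold DistributionRule.externality
  rw [coeff_sub, coeff_erase_eq_zero _ hj, sub_zero]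

variable {ω : WeightSystem N} {g : DistributionRule N} {T : Finset N} {i j : N}

theorem WeightSystem.IsProportional.coeff_share_eq_zero_of_lt (hg : ω.IsProportional g)
    (hi : i ∈ T) (hlt : ω.cls i < ω.cls j) : coeff (g.share j) T = 0 := by
  rw [← coeff_externality g hi]
  exact Finset.sum_eq_zero fun S _ => mul_eq_zero_of_right _ ((hg S i j).1 hlt)

theorem WeightSystem.IsProportional.coeff_share_mul_weight (hg : ω.IsProportional g)
    (hi : i ∈ T) (hj : j ∈ T) (heq : ω.cls i = ω.cls j) :
    coeff (g.share i) T * ω.weight j = coeff (g.share j) T * ω.weight i := by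
  rw [← coeff_externality g hj, ← coeff_externality g hi]
  unfold coeff
  rw [Finset.sum_mul, Finset.sum_mul]
  exact Finset.sum_congr rfl fun S _ => by rw [mul_assoc, mul_assoc, (hg S i j).2 heq]

end Coefficients

section Recovery

variable {N : Type*} [Fintype N] [DecidableEq N] (ω : WeightSystem N)

namespace WeightSystem

theorem mem_top {T : Finset N} {i : N} : i ∈ ω.top T ↔ i ∈ T ∧ ∀ j ∈ T, ω.cls i ≤ ω.cls j := by
  simp [top]

theorem sum_weight_top_pos {T : Finset N} (hT : T.Nonempty) : 0 < ∑ j ∈ ω.top T, ω.weight j := by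
  refine Finset.sum_pos (fun j _ => ω.weight_pos j) ?_
  obtain ⟨i, hi, hmin⟩ := T.exists_min_image ω.cls hT
  exact ⟨i, ω.mem_top.2 ⟨hi, hmin⟩⟩

theorem inclusion_remaining_sub (S T : Finset N) (i : N) :
    inclusion T (ω.remaining S (ω.cls i)) - inclusion T ((ω.remaining S (ω.cls i)).erase i) =
      if T ⊆ S ∧ i ∈ ω.top T then 1 else 0 := by
  simp only [inclusion, Finset.subset_erase]
  by_cases hi : i ∈ T
  · have hiff : T ⊆ ω.remaining S (ω.cls i) ↔ T ⊆ S ∧ i ∈ ω.top T := by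
      simp only [Finset.subset_iff, ω.mem_remaining, ω.mem_top, hi, true_and]
      exact forall₂_and
    simp [hi, hiff]
  · simp [hi, ω.mem_top]

end WeightSystem

theorem gwmc_rescale_share (W : WelfareFunction N) (i : N) (S : Finset N) :
    (gwmc ω (rescale ω W)).share i S = ∑ T ∈ S.powerset,
      if i ∈ ω.top T then ω.weight i * (coeff W T / ∑ j ∈ ω.top T, ω.weight j) else 0 := by
  simp only [gwmc, rescale, Finset.sum_apply, Pi.smul_apply, smul_eq_mul,
    ← Finset.sum_sub_distrib, ← mul_sub, ω.inclusion_remaining_sub]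
  rw [Finset.mul_sum, ← Finset.sum_filter]
  symm
  refine Finset.sum_subset_zero_on_sdiff (fun T hT => ?_) (fun T hT => ?_) fun T hT => ?_
  · obtain ⟨-, hi⟩ := Finset.mem_filter.1 hT
    exact Finset.mem_filter.2 ⟨Finset.mem_univ _, i, (ω.mem_top.1 hi).1⟩
  · have hT' := (Finset.mem_sdiff.1 hT).2
    rw [Finset.mem_filter, Finset.mem_powerset] at hT'
    rw [if_neg hT', mul_zero, mul_zero]
  · rw [Finset.mem_filter, Finset.mem_powerset] at hT
    rw [if_pos hT, mul_one]

variable {ω} {g : DistributionRule N} {T : Finset N} {i : N}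

namespace WeightSystem.IsProportional

theorem coeff_share_eq_zero_of_notMem_top (hg : ω.IsProportional g) (hi : i ∉ ω.top T) :
    coeff (g.share i) T = 0 := by
  by_cases hiT : i ∈ T
  · obtain ⟨j, hjT, hlt⟩ : ∃ j ∈ T, ω.cls j < ω.cls i := by
      by_contra! hmin
      exact hi (ω.mem_top.2 ⟨hiT, hmin⟩)
    exact hg.coeff_share_eq_zero_of_lt hjT hlt
  · exact coeff_share_eq_zero g hiT

theorem coeff_share_mul_sum_weight_top (hg : ω.IsProportional g) (hi : i ∈ ω.top T) :
    coeff (g.share i) T * ∑ j ∈ ω.top T, ω.weight j =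
      ω.weight i * coeff (distributed g) T := by
  obtain ⟨hiT, hmin⟩ := ω.mem_top.1 hi
  have hsupport : ∑ j ∈ ω.top T, coeff (g.share j) T = ∑ j ∈ T, coeff (g.share j) T :=
    Finset.sum_subset (Finset.filter_subset _ _) fun j _ => hg.coeff_share_eq_zero_of_notMem_top
  rw [coeff_distributed, ← hsupport, Finset.mul_sum, Finset.mul_sum]
  refine Finset.sum_congr rfl fun j hj => ?_
  obtain ⟨hjT, hjmin⟩ := ω.mem_top.1 hj
  rw [hg.coeff_share_mul_weight hiT hjT ((hmin j hjT).antisymm (hjmin i hiT)), mul_comm]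

theorem eq_gwmc (hg : ω.IsProportional g) : g = gwmc ω (rescale ω (distributed g)) := by
  ext i S
  rw [gwmc_rescale_share, ← sum_coeff_powerset (g.share i) S]
  refine Finset.sum_congr rfl fun T _ => ?_
  split_ifs with hi
  · have hpos := ω.sum_weight_top_pos ⟨i, (ω.mem_top.1 hi).1⟩
    rw [mul_div_assoc', eq_div_iff hpos.ne', hg.coeff_share_mul_sum_weight_top hi]
  · exact hg.coeff_share_eq_zero_of_notMem_top hi

end WeightSystem.IsProportional

end Recovery

end WelfareSharing

theorem theorem2 {N : Type*} [Fintype N] [DecidableEq N]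
    (𝕎 : Set (WelfareSharing.WelfareFunction N))
    (f : 𝕎 → WelfareSharing.DistributionRule N) :
    (∀ G : WelfareSharing.WelfareGame 𝕎, ∃ a : N → Finset G.Resource, G.IsPureNash f a) ↔
      ∃ (ω : WelfareSharing.WeightSystem N) (gMC : 𝕎 → WelfareSharing.WelfareFunction N),
        (∀ W : 𝕎, gMC W = WelfareSharing.rescale ω (WelfareSharing.distributed (f W))) ∧
          ∀ W : 𝕎, f W = WelfareSharing.gwmc ω (gMC W) := by
  constructor
  · intro hf
    obtain ⟨ω, hω⟩ := WelfareSharing.GuaranteesNash.exists_isProportional hf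
    exact ⟨ω, _, fun _ => rfl, fun W => (hω W).eq_gwmc⟩
  · rintro ⟨ω, gMC, -, hf⟩ G
    obtain rfl : f = fun W => WelfareSharing.gwmc ω (gMC W) := funext hf
    exact G.exists_isPureNash_gwmc ω gMC
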